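/- Let $G=(V,E)$ be a finite strongly connected directed graph (no parallel arcs; loops allowed). **Definitions.** Let $\mathcal L$ be a cyclic ordering of a set of vertices. For $a\ne b$ in $\mathcal L$, $(a,b)$ is the set of vertices met strictly between $a$ and $b$ when going forward from $a$, and $[a,b)=\{a\}\cup(a,b)$; $(a,a)$ is the set of all vertices of $\mathcal L$ except $a$. The other cyclic intervals are defined likewise. An *interval routing scheme* for $G$ is a cyclic ordering of $V$ together with a set of cyclic intervals assigned to each arc, such that for each vertex $u$ the intervals on the arcs leaving $u$ are pairwise disjoint and have union $V\setminus\{u\}$. A message with destination $d$ at a vertex $u\ne d$ is forwarded along the arc leaving $u$ that has an interval containing $d$. The scheme is *feasible* if from every vertex, a message destined for any vertex reaches it. An *ear decomposition* of $G$ is a partition of $E$ into a simple directed cycle $P_0$ with at least two arcs and simple directed paths or cycles (*ears*) $P_1,\dots,P_k$ such that for every $i\ge1$ the ends of $P_i$ (which may coincide) lie on $\bigcup_{j<i}P_j$ and the internal vertices of $P_i$ do not. Single-arc ears (including loops) are allowed. The procedure *Routing*, given $P_0$ and ears $P_1,\dots,P_r$ with at least two arcs each, starts with the vertices of $P_0$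 in their cyclic order as $\mathcal L$, and assigns $(a,a)$ to each arc $ab$ of $P_0$. Then for $i=1,\dots,r$, where $v_1,v_2,\dots,v_p$ are the vertices of $P_i$ in order without its last vertex: insert $v_2,\dots,v_p$ into $\mathcal L$ immediately after $v_1$; assign $(v_j,v_j)$ to the arc of $P_i$ leaving $v_j$ for $2\le j\le p$; let $v_1u$ be the arc leaving $v_1$ that is assigned an interval of the form $(v_1,a)$; let $b$ be the vertex following $v_p$ in $\mathcal L$; reassign $[b,a)$ to $v_1u$ and assign $(v_1,b)$ to $v_1v_2$. **Theorem.** 1. If $|V|\ge2$, then $G$ has an ear decomposition. 2. For every ear decomposition of $G$, the procedure Routing, run on $P_0$ and those ears that have at least two arcs (in their order), never gets stuck and has exactly one possible output. This output is a feasible interval routing scheme for $G$ in which each arc of $P_0$ and of these ears has exactly one interval, which is nonempty, and the arcs of single-arc ears have none. 3. Consequently $G$ has a feasible interval routing scheme in which each arc has exactly one cyclic interval, where the arcs with nonempty interval are precisely the arcs of some strongly connected spanning subdigraph of $G$ (the remaining arcs, not needed for routing, carry an empty interval). -/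

import Mathlib

namespace IntervalRouting

/-- Every vertex can be reached from every vertex by a directed path (possibly trivial). -/
def StronglyConnected {V : Type*} (G : Digraph V) : Prop :=
  ∀ u v : V, Relation.ReflTransGen G.Adj u v

/-! ### Ear decompositions -/

/-- An ear: a directed walk `first, inner₁, …, innerₘ, last`. It has `m + 1` arcs, and it is
closed when `first = last`. -/
structure Ear (V : Type*) where
  first : V
  inner : List V
  last : V

/-- The arcs of an ear that leave its internal vertices, in order. -/
def Ear.innerArcs {V : Type*} (e : Ear V) : List (V × V) :=
  e.inner.zip (e.inner.tail ++ [e.last])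

/-- All the arcs of an ear, in order. -/
def Ear.arcs {V : Type*} (e : Ear V) : List (V × V) :=
  (e.first :: e.inner).zip (e.inner ++ [e.last])

/-- The arcs of the closed walk through the vertices listed in `c`. -/
def cycleArcs {V : Type*} (c : List V) : List (V × V) :=
  c.zip (c.rotate 1)

/-- The arcs of the initial cycle `c` and of the ears. -/
def allArcs {V : Type*} (c : List V) (ears : List (Ear V)) : List (V × V) :=
  cycleArcs c ++ ears.flatMap Ear.arcs

/-- `W` is the set of vertices already present. Each ear is simple, its two ends are already
present, and none of its internal vertices is. -/
def EarsAttach {V : Type*} (W : Set V) : List (Ear V) → Prop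
  | [] => True
  | e :: es => e.first ∈ W ∧ e.last ∈ W ∧ e.inner.Nodup ∧ (∀ v ∈ e.inner, v ∉ W) ∧
      EarsAttach (W ∪ {v | v ∈ e.inner}) es

/-- An ear decomposition of `G`: a simple directed cycle `c` (with at least two arcs, so not a
loop) and ears whose arcs together partition the arcs of `G`. Ears with a single arc (loops
included) are allowed. -/
structure IsEarDecomposition {V : Type*} (G : Digraph V) (c : List V) (ears : List (Ear V)) :
    Prop where
  two_le_length : 2 ≤ c.length
  nodup : c.Nodup
  attach : EarsAttach {v | v ∈ c} ears
  arcs_nodup : (allArcs c ears).Nodup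
  adj_iff : ∀ u v : V, G.Adj u v ↔ (u, v) ∈ allArcs c ears

/-- The ears with at least two arcs. -/
def longEars {V : Type*} (ears : List (Ear V)) : List (Ear V) :=
  ears.filter (fun e => !e.inner.isEmpty)

/-! ### Cyclic orderings, cyclic intervals and routing -/

/-- A cyclic interval, given by its end points: `(a,b)`, `[a,b)`, `(a,b]` or `[a,b]`. -/
inductive CyclicInterval (V : Type*) where
  | ioo (a b : V)
  | ico (a b : V)
  | ioc (a b : V)
  | icc (a b : V)

/-- A list without repetition is read as a cyclic ordering (the last entry is followed by the
first). This is the number of forward steps from `a` to `x`. -/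
def offset {V : Type*} [DecidableEq V] (L : List V) (a x : V) : ℕ :=
  (L.idxOf x + (L.length - L.idxOf a)) % L.length

/-- Membership in a cyclic interval of the cyclic ordering `L`. If the end points agree,
`(a,a)` is everything except `a`, `[a,a]` is `{a}`, and the half-open intervals are everything. -/
def CyclicInterval.Mem {V : Type*} [DecidableEq V] (L : List V) (x : V) :
    CyclicInterval V → Prop
  | ioo a b => x ∈ L ∧ 0 < offset L a x ∧ (a = b ∨ offset L a x < offset L a b)
  | ico a b => x ∈ L ∧ (a = b ∨ offset L a x < offset L a b)
  | ioc a b => x ∈ L ∧ (a = b ∨ (0 < offset L a x ∧ offset L a x ≤ offset L a b))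
  | icc a b => x ∈ L ∧ offset L a x ≤ offset L a b

/-- A cyclic ordering of vertices, and for each pair `(u, v)` the set of the intervals assigned
to the arc from `u` to `v`. -/
@[ext] structure Labeling (V : Type*) where
  order : List V
  label : V → V → Set (CyclicInterval V)

/-- An interval routing scheme for `G`: the order is a cyclic ordering of all the vertices, only
arcs are labeled, and for each vertex `u` the intervals on the arcs leaving `u` are pairwise
disjoint with union all vertices except `u`. -/
structure IsIntervalRoutingScheme {V : Type*} [DecidableEq V] (G : Digraph V) (S : Labeling V) :
    Prop where
  nodup : S.order.Nodup
  mem_order : ∀ v : V, v ∈ S.order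
  adj_of_label : ∀ u v : V, (S.label u v).Nonempty → G.Adj u v
  cover : ∀ u d : V, d ≠ u →
    ∃! p : V × CyclicInterval V, p.2 ∈ S.label u p.1 ∧ p.2.Mem S.order d
  not_mem_self : ∀ u v : V, ∀ I ∈ S.label u v, ¬ I.Mem S.order u

/-- A message with destination `d` that is at `u ≠ d` is forwarded along the arc from `u` to `v`. -/
def Forwards {V : Type*} [DecidableEq V] (G : Digraph V) (S : Labeling V) (d u v : V) : Prop :=
  u ≠ d ∧ G.Adj u v ∧ ∃ I ∈ S.label u v, I.Mem S.order d

/-- Every message reaches its destination. -/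
def Feasible {V : Type*} [DecidableEq V] (G : Digraph V) (S : Labeling V) : Prop :=
  ∀ x d : V, Relation.ReflTransGen (Forwards G S d) x d

/-! ### The procedure Routing -/

/-- Insert the list `xs` immediately after `v`. -/
def insertAfter {V : Type*} [DecidableEq V] (v : V) (xs : List V) : List V → List V
  | [] => []
  | x :: l => if x = v then x :: (xs ++ l) else x :: insertAfter v xs l

/-- (Re)assign the single interval `I` to the arc from `u` to `v`. -/
def assign {V : Type*} [DecidableEq V] (lab : V → V → Set (CyclicInterval V)) (u v : V)
    (I : CyclicInterval V) : V → V → Set (CyclicInterval V) :=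
  fun x y => if x = u ∧ y = v then {I} else lab x y

/-- Assign to each arc `(a, b)` in the list the interval `(a,a)`. -/
def assignFull {V : Type*} [DecidableEq V] (lab : V → V → Set (CyclicInterval V))
    (A : List (V × V)) : V → V → Set (CyclicInterval V) :=
  fun x y => if (x, y) ∈ A then {CyclicInterval.ioo x x} else lab x y

/-- The state after the initial cycle `c` has been processed. -/
def routingInit {V : Type*} [DecidableEq V] (c : List V) : Labeling V where
  order := c
  label := assignFull (fun _ _ => ∅) (cycleArcs c)

/-- Processing the ear `e = v₁ v₂ … vₚ last` in state `S` can lead to state `T`: insert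
`v₂, …, vₚ` after `v₁`; assign `(vⱼ,vⱼ)` to the arc leaving `vⱼ`; pick an arc from `v₁` to some
`u` that carries an interval `(v₁,a)`; with `b` the vertex following `vₚ`, reassign `[b,a)` to
that arc and assign `(v₁,b)` to the arc from `v₁` to `v₂`. -/
def RoutingStep {V : Type*} [DecidableEq V] (S : Labeling V) (e : Ear V) (T : Labeling V) : Prop :=
  ∃ v₂ vₚ u a b : V, e.inner.head? = some v₂ ∧ e.inner.getLast? = some vₚ ∧
    CyclicInterval.ioo e.first a ∈ assignFull S.label e.innerArcs e.first u ∧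
    T.order = insertAfter e.first e.inner S.order ∧
    (∃ h : vₚ ∈ T.order, b = T.order.next vₚ h) ∧
    T.label = assign (assign (assignFull S.label e.innerArcs) e.first u (CyclicInterval.ico b a))
      e.first v₂ (CyclicInterval.ioo e.first b)

/-- Processing the ears in the given order from state `S` can lead to state `T`. -/
def RoutingRun {V : Type*} [DecidableEq V] : Labeling V → List (Ear V) → Labeling V → Prop
  | S, [], T => T = S
  | S, e :: es, T => ∃ S', RoutingStep S e S' ∧ RoutingRun S' es T

/-- The procedure, run on the cycle `c` and the given ears, can end with output `T`. -/
def Routing {V : Type*} [DecidableEq V] (c : List V) (ears : List (Ear V)) (T : Labeling V) :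
    Prop :=
  RoutingRun (routingInit c) ears T

end IntervalRouting

namespace IntervalRouting

variable {V : Type*}

/-! ### Arcs of walks -/

/-! Existence of ear decompositions: as long as an arc is missing, strong connectivity gives a
missing arc that starts in the part already built. A path from its head back to that part completes
an ear. Each ear uses up arcs, so this stops (`exists_path_to_set`, `exists_ears`).

Correctness of the procedure is an induction over the ears with the invariant `IsRoutingState`, in
which every vertex `u` has exactly one free interval `(u,a)`. Let an ear be inserted right after
`v`. No endpoint of an old interval separates the new vertices from `v`, so every old interval
except the free one of `v` contains a new vertex iff it contains `v`
(`mem_insertAfter_inserted_iff`), while membership of old vertices does not change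
(`mem_insertAfter_iff`). The free interval of `v` splits into `[b,a)`, with the same old vertices as
before, and `(v,b)`, consisting exactly of the new ones (`split_ioo`). Hence a message for an old
vertex travels as before, and one for a new vertex travels as if addressed to `v` and then enters
the ear. A message inside the ear moves along it until it is delivered or reaches the old vertex at
the end (`reaches_of_arcs`). This is `IsRoutingState.step`. The free interval of `v` is determined,
which makes the output unique.

The last claim follows by putting empty intervals on the remaining arcs. -/

theorem arcs_nil (f t : V) : (Ear.mk f [] t).arcs = [(f, t)] := rfl

theorem arcs_cons (f x t : V) (l : List V) :
    (Ear.mk f (x :: l) t).arcs = (f, x) :: (Ear.mk x l t).arcs := rfl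

theorem innerArcs_cons (f x t : V) (l : List V) :
    (Ear.mk f (x :: l) t).innerArcs = (Ear.mk x l t).arcs := rfl

theorem cycleArcs_cons (u : V) (l : List V) : cycleArcs (u :: l) = (Ear.mk u l u).arcs := by
  simp [cycleArcs, Ear.arcs]

/-- This list of sources is why, on a simple ear, an arc is determined by the vertex it leaves. -/
theorem map_fst_arcs (e : Ear V) : e.arcs.map Prod.fst = e.first :: e.inner := by
  unfold Ear.arcs
  rw [List.map_fst_zip]
  simp

theorem fst_mem_of_mem_arcs {e : Ear V} {x y : V} (h : (x, y) ∈ e.arcs) :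
    x = e.first ∨ x ∈ e.inner := by
  simpa using (List.of_mem_zip h).1

theorem snd_mem_of_mem_arcs {e : Ear V} {x y : V} (h : (x, y) ∈ e.arcs) :
    y ∈ e.inner ∨ y = e.last := by
  simpa using (List.of_mem_zip h).2

theorem nodup_arcs {e : Ear V} (h : (e.first :: e.inner).Nodup) : e.arcs.Nodup := by
  rw [← map_fst_arcs] at h
  exact h.of_map

theorem exists_mem_arcs {e : Ear V} {x : V} (h : x ∈ e.first :: e.inner) :
    ∃ y, (x, y) ∈ e.arcs := by
  rw [← map_fst_arcs] at h
  simpa using h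

theorem eq_of_mem_arcs {e : Ear V} (hn : (e.first :: e.inner).Nodup) {x y z : V}
    (hy : (x, y) ∈ e.arcs) (hz : (x, z) ∈ e.arcs) : y = z := by
  rw [← map_fst_arcs] at hn
  have := List.inj_on_of_nodup_map hn hy hz rfl
  simpa using this

/-- `R` is only assumed away from `d`, as a message stops at its destination: following the walk, it
either meets `d` or runs to the end `t`. -/
theorem reaches_of_arcs {R : V → V → Prop} {d : V} (l : List V) (f t : V)
    (h : ∀ x y, (x, y) ∈ (Ear.mk f l t).arcs → x ≠ d → R x y) :
    (∀ x ∈ f :: l, Relation.ReflTransGen R x d ∨ Relation.ReflTransGen R x t) ∧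
      (d ∈ f :: l → Relation.ReflTransGen R f d) := by
  induction l generalizing f with
  | nil =>
    rw [arcs_nil] at h
    by_cases hf : f = d
    · subst hf
      simp [Relation.ReflTransGen.refl]
    · have := h f t (by simp) hf
      simp [Ne.symm hf, Relation.ReflTransGen.single this]
  | cons z l ih =>
    rw [arcs_cons] at h
    obtain ⟨ih₁, ih₂⟩ := ih z (fun x y hxy hx => h x y (by simp [hxy]) hx)
    by_cases hf : f = d
    · subst hf
      refine ⟨fun x hx => ?_, fun _ => .refl⟩
      rcases List.mem_cons.1 hx with rfl | hx
      · exact .inl .refl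
      · exact ih₁ x hx
    · have hR := h f z (by simp) hf
      refine ⟨fun x hx => ?_, fun hd => ?_⟩
      · rcases List.mem_cons.1 hx with rfl | hx
        · exact (ih₁ z (by simp)).imp (.head hR) (.head hR)
        · exact ih₁ x hx
      · rcases List.mem_cons.1 hd with rfl | hd
        · exact absurd rfl hf
        · exact .head hR (ih₂ hd)

theorem arcs_append_subset (f x t : V) (s l : List V) :
    (Ear.mk x l t).arcs ⊆ (Ear.mk f (s ++ x :: l) t).arcs := by
  induction s generalizing f with
  | nil => simp [arcs_cons]
  | cons z s ih =>
    rw [List.cons_append, arcs_cons]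
    exact fun p hp => List.mem_cons_of_mem _ (ih z hp)

theorem longEars_arcs_subset {ears : List (Ear V)} {c : List V} {p : V × V}
    (h : p ∈ allArcs c (longEars ears)) : p ∈ allArcs c ears := by
  simp only [allArcs, longEars, List.mem_append, List.mem_flatMap, List.mem_filter] at h ⊢
  exact h.imp_right fun ⟨e, he, hp⟩ => ⟨e, he.1, hp⟩

/-! ### Existence of ear decompositions -/

/-- The start `f` is arbitrary and its arc to `x` need not lie in `G`. This lets the induction
prepend a vertex, and later lets the path be attached to any tail of an arc into `x`. -/
theorem exists_path_to_set {G : Digraph V} {W : Set V} {x w : V} (hw : w ∈ W)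
    (h : Relation.ReflTransGen G.Adj x w) :
    ∃ (l : List V) (t : V), t ∈ W ∧ l.Nodup ∧ (∀ v ∈ l, v ∉ W) ∧
      ∀ f, ∃ A, (Ear.mk f l t).arcs = (f, x) :: A ∧ ∀ p ∈ A, G.Adj p.1 p.2 := by
  classical
  induction h using Relation.ReflTransGen.head_induction_on with
  | refl => exact ⟨[], w, hw, by simp, by simp, fun f => ⟨[], by simp [arcs_nil]⟩⟩
  | @head x y hxy _ ih =>
    by_cases hx : x ∈ W
    · exact ⟨[], x, hx, by simp, by simp, fun f => ⟨[], by simp [arcs_nil]⟩⟩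
    obtain ⟨l, t, ht, hl, hlW, hA⟩ := ih
    obtain ⟨A, hA₁, hA₂⟩ := hA x
    have hadj : ∀ p ∈ (Ear.mk x l t).arcs, G.Adj p.1 p.2 := by
      rw [hA₁]
      simpa [hxy] using fun a b => hA₂ (a, b)
    -- If the path already visits `x`, the detour up to that visit is cut out.
    by_cases hxl : x ∈ l
    · obtain ⟨s, r, rfl⟩ := List.append_of_mem hxl
      refine ⟨x :: r, t, ht, hl.of_append_right, fun v hv => hlW v (by simp_all), fun f =>
        ⟨_, arcs_cons _ _ _ _, fun p hp => hadj p (arcs_append_subset _ _ _ _ _ hp)⟩⟩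
    · exact ⟨x :: l, t, ht, by simp [hxl, hl], by simpa [hx] using hlW, fun f =>
        ⟨_, arcs_cons _ _ _ _, hadj⟩⟩

theorem exists_adj_leaving {r : V → V → Prop} {W : Set V} {w x : V} (hw : w ∈ W) (hx : x ∉ W)
    (h : Relation.ReflTransGen r w x) : ∃ a b, a ∈ W ∧ b ∉ W ∧ r a b := by
  induction h with
  | refl => exact absurd hw hx
  | @tail y z _ hyz ih =>
    by_cases hy : y ∈ W
    · exact ⟨y, z, hy, hx, hyz⟩
    · exact ih hy

/-- `A` holds the arcs used so far, all inside `W`. The number `n` bounds how many pairs are still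
unused, and it decreases because every ear has an arc. -/
theorem exists_ears [Finite V] {G : Digraph V} (hG : StronglyConnected G) (n : ℕ) (W : Set V)
    (A : List (V × V)) (hW : W.Nonempty) (hA : A.Nodup) (hAW : ∀ p ∈ A, p.1 ∈ W)
    (hAG : ∀ p ∈ A, G.Adj p.1 p.2) (hn : Nat.card (V × V) ≤ A.length + n)
    (hAW' : ∀ p ∈ A, p.2 ∈ W) :
    ∃ ears : List (Ear V), EarsAttach W ears ∧ (A ++ ears.flatMap Ear.arcs).Nodup ∧
      ∀ u v, G.Adj u v ↔ (u, v) ∈ A ++ ears.flatMap Ear.arcs := by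
  classical
  have := Fintype.ofFinite V
  rw [Nat.card_eq_fintype_card] at hn
  by_cases hall : ∀ u v, G.Adj u v → (u, v) ∈ A
  · exact ⟨[], trivial, by simpa using hA, fun u v => ⟨fun h => by simpa using hall u v h,
      fun h => hAG _ (by simpa using h)⟩⟩
  -- If the missing arc starts outside `W`, some arc leaves `W`; it is missing too, because arcs of
  -- `A` end in `W`.
  have hstart : ∃ a b, a ∈ W ∧ G.Adj a b ∧ (a, b) ∉ A := by
    push Not at hall
    obtain ⟨u, v, huv, hnot⟩ := hall
    by_cases hu : u ∈ W
    · exact ⟨u, v, hu, huv, hnot⟩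
    · obtain ⟨w, hw⟩ := hW
      obtain ⟨a, b, ha, hb, hab⟩ := exists_adj_leaving hw hu (hG w u)
      exact ⟨a, b, ha, hab, fun h => hb (hAW' _ h)⟩
  obtain ⟨a, b, ha, hab, hnew⟩ := hstart
  obtain ⟨w, hw⟩ := hW
  obtain ⟨l, t, ht, hl, hlW, hP⟩ := exists_path_to_set hw (hG b w)
  obtain ⟨P, hP₁, hP₂⟩ := hP a
  have hal : (a :: l).Nodup := List.nodup_cons.2 ⟨fun h => hlW a h ha, hl⟩
  have hdisj : ∀ p ∈ A, p ∉ (Ear.mk a l t).arcs := by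
    rintro ⟨x, y⟩ hxy hp
    rcases fst_mem_of_mem_arcs hp with h | h
    · obtain rfl : x = a := h
      have hy : y = b := eq_of_mem_arcs (e := Ear.mk x l t) hal hp (by simp [hP₁])
      exact hnew (hy ▸ hxy)
    · exact hlW x h (hAW _ hxy)
  have hnd : (A ++ (Ear.mk a l t).arcs).Nodup :=
    List.Nodup.append hA (nodup_arcs (e := Ear.mk a l t) hal) hdisj
  cases n with
  | zero =>
    have := hnd.length_le_card
    simp [hP₁] at this
    simp at hn
    omega
  | succ n =>
    obtain ⟨es, h₁, h₂, h₃⟩ := exists_ears hG n (W ∪ {v | v ∈ l}) (A ++ (Ear.mk a l t).arcs)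
      ⟨w, .inl hw⟩ hnd
      (by
        rintro ⟨x, y⟩ h
        rcases List.mem_append.1 h with h | h
        · exact .inl (hAW _ h)
        · rcases fst_mem_of_mem_arcs h with h | h
          · exact .inl (by simpa [h] using ha)
          · exact .inr h)
      (by
        intro p h
        rcases List.mem_append.1 h with h | h
        · exact hAG _ h
        · rw [hP₁] at h
          rcases List.mem_cons.1 h with rfl | h
          · exact hab
          · exact hP₂ p h)
      (by
        rw [Nat.card_eq_fintype_card]
        simp only [List.length_append, hP₁, List.length_cons]
        omega)
      (by
        rintro ⟨x, y⟩ h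
        rcases List.mem_append.1 h with h | h
        · exact .inl (hAW' _ h)
        · rcases snd_mem_of_mem_arcs h with h | h
          · exact .inr h
          · exact .inl (by simpa [h] using ht))
    exact ⟨Ear.mk a l t :: es, ⟨ha, ht, hl, hlW, h₁⟩, by simpa using h₂, by simpa using h₃⟩

theorem exists_isEarDecomposition [Finite V] [Nontrivial V] {G : Digraph V}
    (hG : StronglyConnected G) : ∃ c ears, IsEarDecomposition G c ears := by
  obtain ⟨u, v, huv⟩ := exists_pair_ne V
  obtain ⟨a, b, ha, hb, hab⟩ :=
    exists_adj_leaving (W := {u}) rfl (by simpa using huv.symm) (hG u v)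
  obtain rfl : a = u := ha
  obtain ⟨l, t, ht, hl, hla, hP⟩ := exists_path_to_set (W := {a}) rfl (hG b a)
  obtain rfl : t = a := ht
  obtain ⟨P, hP₁, hP₂⟩ := hP t
  have hcl : (t :: l).Nodup := List.nodup_cons.2 ⟨fun h => hla t h rfl, hl⟩
  -- A single arc would be a loop, but the chosen arc leaves `{t}`.
  have hne : l ≠ [] := by
    rintro rfl
    simp only [arcs_nil, List.cons.injEq, Prod.mk.injEq] at hP₁
    exact hb hP₁.1.2.symm
  obtain ⟨ears, h₁, h₂, h₃⟩ := exists_ears hG (Nat.card (V × V)) {v | v ∈ t :: l}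
    (cycleArcs (t :: l)) ⟨t, by simp⟩
    (by rw [cycleArcs_cons]; exact nodup_arcs (e := Ear.mk t l t) hcl)
    (by
      rw [cycleArcs_cons]
      rintro ⟨x, y⟩ h
      simpa using fst_mem_of_mem_arcs h)
    (by
      rw [cycleArcs_cons, hP₁]
      intro p h
      rcases List.mem_cons.1 h with rfl | h
      · exact hab
      · exact hP₂ p h)
    (by omega)
    (by
      rw [cycleArcs_cons]
      rintro ⟨x, y⟩ h
      exact (snd_mem_of_mem_arcs h).elim (List.mem_cons_of_mem _)
        (fun h => h ▸ List.mem_cons_self))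
  exact ⟨t :: l, ears, by
    have := List.length_pos_iff.2 hne
    simp only [List.length_cons]
    omega, hcl, h₁, h₂, h₃⟩

/-! ### Cyclic intervals after an insertion -/

variable [DecidableEq V]

/-- Without the modulus, questions about intervals become linear inequalities between indices, which
`omega` decides. -/
theorem offset_eq {L : List V} {a x : V} (ha : a ∈ L) (hx : x ∈ L) :
    offset L a x = if L.idxOf a ≤ L.idxOf x then L.idxOf x - L.idxOf a
      else L.length + L.idxOf x - L.idxOf a := by
  have h₁ := List.idxOf_lt_length_iff.2 ha
  have h₂ := List.idxOf_lt_length_iff.2 hx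
  unfold offset
  split_ifs with h
  · rw [show L.idxOf x + (L.length - L.idxOf a) = L.idxOf x - L.idxOf a + L.length by omega,
      Nat.add_mod_right, Nat.mod_eq_of_lt (by omega)]
  · rw [Nat.mod_eq_of_lt (by omega)]
    omega

theorem mem_ioo_self {L : List V} {a x : V} (ha : a ∈ L) :
    (CyclicInterval.ioo a a).Mem L x ↔ x ∈ L ∧ x ≠ a := by
  have : x ∈ L → (0 < offset L a x ↔ x ≠ a) := fun hx => by
    have h₁ := List.idxOf_lt_length_iff.2 ha
    rw [offset_eq ha hx, ← not_iff_not, not_not, ← List.idxOf_inj hx]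
    split_ifs <;> omega
  simp only [CyclicInterval.Mem, true_or, and_true]
  tauto

theorem insertAfter_append {v : V} (xs s r : List V) (hv : v ∉ s) :
    insertAfter v xs (s ++ v :: r) = s ++ v :: (xs ++ r) := by
  induction s with
  | nil => simp [insertAfter]
  | cons z s ih =>
    rw [List.mem_cons, not_or] at hv
    simp [insertAfter, Ne.symm hv.1, ih hv.2]

theorem perm_insertAfter {v : V} (xs : List V) {L : List V} (hv : v ∈ L) :
    (insertAfter v xs L).Perm (xs ++ L) := by
  obtain ⟨s, r, rfl, hs⟩ := List.eq_append_cons_of_mem hv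
  rw [insertAfter_append xs s r hs]
  refine List.perm_iff_count.2 fun a => ?_
  simp only [List.count_append, List.count_cons]
  omega

theorem mem_insertAfter {v x : V} {xs L : List V} (hv : v ∈ L) :
    x ∈ insertAfter v xs L ↔ x ∈ L ∨ x ∈ xs := by
  rw [(perm_insertAfter xs hv).mem_iff, List.mem_append, or_comm]

theorem length_insertAfter {v : V} {xs L : List V} (hv : v ∈ L) :
    (insertAfter v xs L).length = L.length + xs.length := by
  rw [(perm_insertAfter xs hv).length_eq, List.length_append, add_comm]

theorem idxOf_insertAfter_of_mem {v x : V} {xs L : List V} (hv : v ∈ L) (hx : x ∈ L)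
    (hxs : x ∉ xs) :
    (insertAfter v xs L).idxOf x =
      if L.idxOf x ≤ L.idxOf v then L.idxOf x else L.idxOf x + xs.length := by
  obtain ⟨s, r, rfl, hs⟩ := List.eq_append_cons_of_mem hv
  rw [insertAfter_append xs s r hs]
  by_cases hxs' : x ∈ s
  · have := List.idxOf_lt_length_iff.2 hxs'
    simp only [List.idxOf_append_of_mem hxs', List.idxOf_append_of_notMem hs]
    rw [if_pos (by omega)]
  · by_cases hxv : v = x
    · subst hxv
      simp [List.idxOf_append_of_notMem hs]
    · simp [List.idxOf_append_of_notMem hs, List.idxOf_append_of_notMem hxs',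
        List.idxOf_cons_ne _ hxv, List.idxOf_append_of_notMem hxs]
      omega

theorem idxOf_insertAfter_of_mem_inserted {v x : V} {xs L : List V} (hv : v ∈ L) (hx : x ∉ L)
    (hxs : x ∈ xs) :
    (insertAfter v xs L).idxOf x = L.idxOf v + 1 + xs.idxOf x := by
  obtain ⟨s, r, rfl, hs⟩ := List.eq_append_cons_of_mem hv
  rw [insertAfter_append xs s r hs]
  simp only [List.mem_append, List.mem_cons, not_or] at hx
  simp [List.idxOf_append_of_notMem hs, List.idxOf_append_of_notMem hx.1,
    List.idxOf_cons_ne _ (Ne.symm hx.2.1), List.idxOf_append_of_mem hxs]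
  omega

theorem idxOf_next {L : List V} (hL : L.Nodup) {x : V} (hx : x ∈ L) :
    L.idxOf (L.next x hx) = if L.idxOf x + 1 < L.length then L.idxOf x + 1 else 0 := by
  have h := List.idxOf_lt_length_iff.2 hx
  rw [List.next_eq_getElem, hL.idxOf_getElem]
  split_ifs with h'
  · exact Nat.mod_eq_of_lt h'
  · rw [show L.idxOf x + 1 = L.length by omega, Nat.mod_self]

theorem mem_ioo_iff {L : List V} {a b x : V} (ha : a ∈ L) (hb : b ∈ L) (hx : x ∈ L) :
    (CyclicInterval.ioo a b).Mem L x ↔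
      (L.idxOf a < L.idxOf x ∧ (L.idxOf x < L.idxOf b ∨ L.idxOf b ≤ L.idxOf a)) ∨
      (L.idxOf x < L.idxOf a ∧ L.idxOf b ≤ L.idxOf a ∧
        (L.idxOf x < L.idxOf b ∨ L.idxOf a = L.idxOf b)) := by
  have h₁ := List.idxOf_lt_length_iff.2 ha
  have h₂ := List.idxOf_lt_length_iff.2 hb
  have h₃ := List.idxOf_lt_length_iff.2 hx
  simp only [CyclicInterval.Mem, hx, true_and, offset_eq ha hx, offset_eq ha hb,
    ← List.idxOf_inj ha]
  split_ifs <;> omega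

theorem mem_ico_iff {L : List V} {a b x : V} (ha : a ∈ L) (hb : b ∈ L) (hx : x ∈ L) :
    (CyclicInterval.ico a b).Mem L x ↔
      (L.idxOf a ≤ L.idxOf x ∧ (L.idxOf x < L.idxOf b ∨ L.idxOf b ≤ L.idxOf a)) ∨
      (L.idxOf x < L.idxOf a ∧ L.idxOf b ≤ L.idxOf a ∧
        (L.idxOf x < L.idxOf b ∨ L.idxOf a = L.idxOf b)) := by
  have h₁ := List.idxOf_lt_length_iff.2 ha
  have h₂ := List.idxOf_lt_length_iff.2 hb
  have h₃ := List.idxOf_lt_length_iff.2 hx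
  simp only [CyclicInterval.Mem, hx, true_and, offset_eq ha hx, offset_eq ha hb,
    ← List.idxOf_inj ha]
  split_ifs <;> omega

/-- The shape of the intervals that the procedure assigns to the arcs leaving `u`. -/
def IsRoutingInterval (L : List V) (u : V) (I : CyclicInterval V) : Prop :=
  (∃ a ∈ L, I = .ioo u a) ∨ ∃ b ∈ L, ∃ a ∈ L, I = .ico b a

/-- Insertion preserves the cyclic order of the old vertices, and the endpoints are old. -/
theorem IsRoutingInterval.mem_insertAfter_iff {L xs : List V} {v u x : V}
    {I : CyclicInterval V} (hI : IsRoutingInterval L u I) (hv : v ∈ L) (hxs : ∀ y ∈ xs, y ∉ L)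
    (hu : u ∈ L) (hx : x ∈ L) : I.Mem (insertAfter v xs L) x ↔ I.Mem L x := by
  have mem {z : V} (hz : z ∈ L) : z ∈ insertAfter v xs L := (mem_insertAfter hv).2 (.inl hz)
  have idx {z : V} (hz : z ∈ L) :=
    idxOf_insertAfter_of_mem hv hz (fun h => hxs z h hz)
  rcases hI with ⟨a, ha, rfl⟩ | ⟨b, hb, a, ha, rfl⟩
  · rw [mem_ioo_iff (mem hu) (mem ha) (mem hx), mem_ioo_iff hu ha hx, idx hu, idx ha, idx hx]
    split_ifs <;> omega
  · rw [mem_ico_iff (mem hb) (mem ha) (mem hx), mem_ico_iff hb ha hx, idx hb, idx ha, idx hx]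
    split_ifs <;> omega

/-- The inserted block directly follows `v`. Only an interval open on the left at `v`, or closed on
the right at `v`, could tell them apart; `huv` excludes the former and the shape of `I` the latter.
-/
theorem IsRoutingInterval.mem_insertAfter_inserted_iff {L xs : List V} {v u y : V}
    {I : CyclicInterval V} (hI : IsRoutingInterval L u I) (hv : v ∈ L) (hxs : ∀ y ∈ xs, y ∉ L)
    (hu : u ∈ L) (hy : y ∈ xs) (huv : ∀ a, I = .ioo u a → u ≠ v) :
    I.Mem (insertAfter v xs L) y ↔ I.Mem L v := by
  have mem {z : V} (hz : z ∈ L) : z ∈ insertAfter v xs L := (mem_insertAfter hv).2 (.inl hz)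
  have idx {z : V} (hz : z ∈ L) :=
    idxOf_insertAfter_of_mem hv hz (fun h => hxs z h hz)
  have mem_y : y ∈ insertAfter v xs L := (mem_insertAfter hv).2 (.inr hy)
  have idx_y := idxOf_insertAfter_of_mem_inserted hv (hxs y hy) hy
  have lt_y := List.idxOf_lt_length_iff.2 hy
  rcases hI with ⟨a, ha, rfl⟩ | ⟨b, hb, a, ha, rfl⟩
  · have hne := huv a rfl
    rw [Ne, ← List.idxOf_inj hu] at hne
    rw [mem_ioo_iff (mem hu) (mem ha) mem_y, mem_ioo_iff hu ha hv, idx hu, idx ha, idx_y]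
    split_ifs <;> omega
  · rw [mem_ico_iff (mem hb) (mem ha) mem_y, mem_ico_iff hb ha hv, idx hb, idx ha, idx_y]
    split_ifs <;> omega

/-- The effect of splitting `(v,a)` into `(v,b)` and `[b,a)` after inserting `xs` just after `v`,
where `b` is the vertex following `xs`. -/
theorem split_ioo {L xs : List V} {v a p : V} (hL : L.Nodup) (hxsn : xs.Nodup)
    (hv : v ∈ L) (hxs : ∀ y ∈ xs, y ∉ L) (ha : a ∈ L) (hw : ∃ w, (CyclicInterval.ioo v a).Mem L w)
    (hp : p ∈ xs.getLast?) (h : p ∈ insertAfter v xs L) :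
    (insertAfter v xs L).next p h ∈ L ∧
    (∀ x ∈ L, (CyclicInterval.ico ((insertAfter v xs L).next p h) a).Mem (insertAfter v xs L) x ↔
      (CyclicInterval.ioo v a).Mem L x) ∧
    (∀ y ∈ xs, ¬ (CyclicInterval.ico ((insertAfter v xs L).next p h) a).Mem
      (insertAfter v xs L) y) ∧
    (∀ x ∈ L, ¬ (CyclicInterval.ioo v ((insertAfter v xs L).next p h)).Mem
      (insertAfter v xs L) x) ∧
    ∀ y ∈ xs, (CyclicInterval.ioo v ((insertAfter v xs L).next p h)).Mem
      (insertAfter v xs L) y := by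
  have mem {z : V} (hz : z ∈ L) : z ∈ insertAfter v xs L := (mem_insertAfter hv).2 (.inl hz)
  have idx {z : V} (hz : z ∈ L) :=
    idxOf_insertAfter_of_mem hv hz (fun h => hxs z h hz)
  have mem_y {y : V} (hy : y ∈ xs) : y ∈ insertAfter v xs L := (mem_insertAfter hv).2 (.inr hy)
  have idx_y {y : V} (hy : y ∈ xs) := idxOf_insertAfter_of_mem_inserted hv (hxs y hy) hy
  have hL' : (insertAfter v xs L).Nodup := (perm_insertAfter xs hv).nodup_iff.2
    (List.Nodup.append hxsn hL hxs)
  have lt {z : V} (hz : z ∈ L) := List.idxOf_lt_length_iff.2 hz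
  have lt_xs {z : V} (hz : z ∈ xs) := List.idxOf_lt_length_iff.2 hz
  obtain ⟨hne, rfl⟩ := List.mem_getLast?_eq_getLast hp
  have hlast := List.getLast_mem hne
  have idx_last : xs.idxOf (xs.getLast hne) = xs.length - 1 := by
    rw [List.getLast_eq_getElem, hxsn.idxOf_getElem]
  have idx_next := idxOf_next hL' h
  have mem_next := List.next_mem (insertAfter v xs L) _ h
  set b := (insertAfter v xs L).next _ h
  rw [idx_y hlast, idx_last, length_insertAfter hv] at idx_next
  have hpos := List.length_pos_iff.2 hne
  have hvlt := lt hv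
  -- Nonemptiness of `(v,a)` is essential: otherwise `b = a`, and `[a,a)` means all vertices.
  obtain ⟨w, hw⟩ := hw
  have hwL : w ∈ L := hw.1
  rw [mem_ioo_iff hv ha hwL] at hw
  have hwlt := lt hwL
  -- The position of `b` is just past the block, or 0 if the block ends the list, so `b` is not in
  -- the block.
  have hb : b ∈ L := by
    refine ((mem_insertAfter hv).1 mem_next).resolve_right fun hb => ?_
    have h₁ := idx_y hb
    have h₂ := lt_xs hb
    rw [idx_next] at h₁
    split_ifs at h₁ <;> omega
  have hblt := lt hb
  have halt := lt ha
  refine ⟨hb, fun x hx => ?_, fun y hy => ?_, fun x hx => ?_, fun y hy => ?_⟩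
  · have hxlt := lt hx
    rw [mem_ico_iff mem_next (mem ha) (mem hx), mem_ioo_iff hv ha hx, idx_next, idx ha, idx hx]
    split_ifs <;> omega
  · have := lt_xs hy
    rw [mem_ico_iff mem_next (mem ha) (mem_y hy), idx_next, idx ha, idx_y hy]
    split_ifs <;> omega
  · have hxlt := lt hx
    rw [mem_ioo_iff (mem hv) mem_next (mem hx), idx_next, idx hv, idx hx]
    split_ifs <;> omega
  · have := lt_xs hy
    rw [mem_ioo_iff (mem hv) mem_next (mem_y hy), idx_next, idx hv, idx_y hy]
    split_ifs <;> omega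

/-! ### Correctness of the procedure -/

/-- The invariant of the procedure: the labeling `S` is a feasible interval routing scheme for the
digraph with vertices `S.order` and arcs `A`, has one interval per arc, which is nonempty, and
exactly one of the intervals leaving each vertex `u` is of the form `(u,a)`. -/
structure IsRoutingState (S : Labeling V) (A : V → V → Prop) : Prop where
  nodup : S.order.Nodup
  arc_mem : ∀ u v, A u v → u ∈ S.order ∧ v ∈ S.order
  label_arc : ∀ u v, A u v → ∃ I, S.label u v = {I} ∧ ∃ w, I.Mem S.order w
  label_nonarc : ∀ u v, ¬ A u v → S.label u v = ∅
  shape : ∀ u v, ∀ I ∈ S.label u v, IsRoutingInterval S.order u I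
  free : ∀ u ∈ S.order, ∃ v a, .ioo u a ∈ S.label u v ∧
    ∀ v' a', .ioo u a' ∈ S.label u v' → v' = v ∧ a' = a
  cover : ∀ u ∈ S.order, ∀ d ∈ S.order, d ≠ u →
    ∃! p : V × CyclicInterval V, p.2 ∈ S.label u p.1 ∧ p.2.Mem S.order d
  not_mem_self : ∀ u v, ∀ I ∈ S.label u v, ¬ I.Mem S.order u
  feasible : ∀ x ∈ S.order, ∀ d ∈ S.order, Relation.ReflTransGen
    (fun u v => u ≠ d ∧ ∃ I ∈ S.label u v, I.Mem S.order d) x d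

theorem IsRoutingState.arc_of_label {S : Labeling V} {A : V → V → Prop} (h : IsRoutingState S A)
    {u v : V} {I : CyclicInterval V} (hI : I ∈ S.label u v) : A u v := by
  by_contra hA
  simp [h.label_nonarc u v hA] at hI

theorem IsRoutingState.congr {S : Labeling V} {A B : V → V → Prop} (h : IsRoutingState S A)
    (hAB : ∀ u v, A u v ↔ B u v) : IsRoutingState S B := by
  rwa [show B = A from funext₂ fun u v => propext (hAB u v).symm]

theorem isRoutingState_routingInit {c : List V} (hc : c.Nodup) (h2 : 2 ≤ c.length) :
    IsRoutingState (routingInit c) (fun u v => (u, v) ∈ cycleArcs c) := by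
  obtain _ | ⟨f, l⟩ := c
  · simp at h2
  have hmem {u v : V} (h : (u, v) ∈ (Ear.mk f l f).arcs) : u ∈ f :: l ∧ v ∈ f :: l :=
    ⟨by simpa using fst_mem_of_mem_arcs h, by simpa [or_comm] using snd_mem_of_mem_arcs h⟩
  have hlab {u v : V} {I : CyclicInterval V} :
      I ∈ (routingInit (f :: l)).label u v ↔ (u, v) ∈ (Ear.mk f l f).arcs ∧ I = .ioo u u := by
    simp only [routingInit, assignFull, cycleArcs_cons]
    split_ifs with h <;> simp [h]
  have hlab' {u v : V} (h : (u, v) ∈ (Ear.mk f l f).arcs) :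
      (routingInit (f :: l)).label u v = {.ioo u u} := by
    ext I
    simp [hlab, h]
  rw [cycleArcs_cons]
  have huniq {u v w : V} := eq_of_mem_arcs (e := Ear.mk f l f) hc (x := u) (y := v) (z := w)
  refine ⟨hc, fun u v => hmem, fun u v h => ⟨_, hlab' h, ?_⟩, ?_, ?_, ?_, ?_, ?_, ?_⟩
  · obtain ⟨w, hw, hwu⟩ : ∃ w ∈ f :: l, w ≠ u := by
      obtain _ | ⟨z, l⟩ := l
      · simp at h2
      by_cases hfu : f = u
      · refine ⟨z, by simp, ?_⟩
        rintro rfl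
        simp [hfu] at hc
      · exact ⟨f, by simp, hfu⟩
    exact ⟨w, (mem_ioo_self (hmem h).1).2 ⟨hw, hwu⟩⟩
  · intro u v h
    ext I
    simp [hlab, h]
  · intro u v I hI
    rw [hlab] at hI
    exact .inl ⟨u, (hmem hI.1).1, hI.2⟩
  · intro u hu
    obtain ⟨v, hv⟩ := exists_mem_arcs (e := Ear.mk f l f) hu
    refine ⟨v, u, hlab.2 ⟨hv, rfl⟩, fun v' a' h => ?_⟩
    rw [hlab] at h
    exact ⟨huniq h.1 hv, by simpa using h.2⟩
  · intro u hu d hd hdu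
    obtain ⟨v, hv⟩ := exists_mem_arcs (e := Ear.mk f l f) hu
    refine ⟨(v, .ioo u u), ⟨hlab.2 ⟨hv, rfl⟩, (mem_ioo_self hu).2 ⟨hd, hdu⟩⟩, ?_⟩
    rintro ⟨v', I⟩ ⟨h, -⟩
    rw [hlab] at h
    exact Prod.ext (huniq h.1 hv) h.2
  · intro u v I hI hm
    rw [hlab] at hI
    obtain ⟨h, rfl⟩ := hI
    exact ((mem_ioo_self (hmem h).1).1 hm).2 rfl
  · intro x hx d hd
    obtain ⟨h₁, h₂⟩ := reaches_of_arcs (d := d)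
      (R := fun u v => u ≠ d ∧ ∃ I ∈ (routingInit (f :: l)).label u v,
        I.Mem (routingInit (f :: l)).order d) l f f
      (fun u v huv hu => ⟨hu, _, hlab.2 ⟨huv, rfl⟩,
        (mem_ioo_self (hmem huv).1).2 ⟨hd, hu.symm⟩⟩)
    exact (h₁ x hx).elim id fun h => h.trans (h₂ hd)

theorem IsRoutingState.step {S : Labeling V} {A : V → V → Prop} (hS : IsRoutingState S A)
    {v last v₂ : V} {t : List V} (hv : v ∈ S.order) (hlast : last ∈ S.order)
    (hn : (v₂ :: t).Nodup) (hnew : ∀ y ∈ v₂ :: t, y ∉ S.order) :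
    ∃ T, (∀ T', RoutingStep S ⟨v, v₂ :: t, last⟩ T' ↔ T' = T) ∧
      IsRoutingState T (fun x y => A x y ∨ (x, y) ∈ (Ear.mk v (v₂ :: t) last).arcs) ∧
      ∀ x, x ∈ T.order ↔ x ∈ S.order ∨ x ∈ v₂ :: t := by
  obtain ⟨u, a, hua, huniq⟩ := hS.free v hv
  have hvin : v ∉ v₂ :: t := fun h => hnew v h hv
  have hinner {x y : V} (h : (x, y) ∈ (Ear.mk v₂ t last).arcs) : x ∈ v₂ :: t := by
    simpa using fst_mem_of_mem_arcs h
  have hfull {x y : V} (hx : x ∈ S.order) :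
      assignFull S.label (Ear.mk v₂ t last).arcs x y = S.label x y :=
    if_neg fun h => hnew x (hinner h) hx
  have hu : u ∈ S.order := (hS.arc_mem _ _ (hS.arc_of_label hua)).2
  -- The two reassigned arcs differ, so the second `assign` does not overwrite the first.
  have huv₂ : u ≠ v₂ := fun h => hnew v₂ (by simp) (h ▸ hu)
  have ha : a ∈ S.order := by
    rcases hS.shape _ _ _ hua with ⟨a', ha', h⟩ | ⟨b, -, a', -, h⟩
    · obtain ⟨-, rfl⟩ := CyclicInterval.ioo.inj h
      exact ha'
    · cases h
  have hne : ∃ w, (CyclicInterval.ioo v a).Mem S.order w := by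
    obtain ⟨I, hI, hw⟩ := hS.label_arc _ _ (hS.arc_of_label hua)
    rw [hI] at hua
    rwa [Set.mem_singleton_iff.1 hua]
  obtain ⟨p, hp⟩ : ∃ p, (v₂ :: t).getLast? = some p := ⟨_, List.getLast?_cons⟩
  have hpL : p ∈ insertAfter v (v₂ :: t) S.order :=
    (mem_insertAfter hv).2 (.inr (List.mem_of_getLast? hp))
  obtain ⟨hb, hico, hico', hioo, hioo'⟩ := split_ioo hS.nodup hn hv hnew ha hne hp hpL
  set b := (insertAfter v (v₂ :: t) S.order).next p hpL with hbdef
  have memL {x : V} : x ∈ insertAfter v (v₂ :: t) S.order ↔ x ∈ S.order ∨ x ∈ v₂ :: t :=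
    mem_insertAfter hv
  obtain ⟨T, hTo, hTl⟩ : ∃ T : Labeling V, T.order = insertAfter v (v₂ :: t) S.order ∧
      T.label = assign (assign (assignFull S.label (Ear.mk v₂ t last).arcs) v u (.ico b a))
        v v₂ (.ioo v b) := ⟨⟨_, _⟩, rfl, rfl⟩
  have row_old {x y : V} (hx : x ∈ S.order) (hxv : x ≠ v) : T.label x y = S.label x y := by
    simp [hTl, assign, hxv, hfull hx]
  have row_v₂ : T.label v v₂ = {.ioo v b} := by simp [hTl, assign]
  have row_u : T.label v u = {.ico b a} := by simp [hTl, assign, huv₂]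
  have row_v {y : V} (h₁ : y ≠ v₂) (h₂ : y ≠ u) : T.label v y = S.label v y := by
    simp [hTl, assign, h₁, h₂, hfull hv]
  have row_new {x y : V} {I : CyclicInterval V} (hx : x ∈ v₂ :: t) :
      I ∈ T.label x y ↔ (x, y) ∈ (Ear.mk v₂ t last).arcs ∧ I = .ioo x x := by
    have hxv : x ≠ v := fun h => hvin (h ▸ hx)
    have : S.label x y = ∅ :=
      hS.label_nonarc _ _ fun h => hnew x hx (hS.arc_mem _ _ h).1
    simp only [hTl, assign, hxv, false_and, if_false, assignFull, this]
    split_ifs with h <;> simp [h]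
  -- In the first alternative the interval is inherited and is not the free interval of `v`, as
  -- `mem_new` requires.
  have row_cases {x y : V} {I : CyclicInterval V} (h : I ∈ T.label x y) :
      (x ∈ S.order ∧ I ∈ S.label x y ∧ ∀ a', I = .ioo x a' → x ≠ v) ∨
      (x = v ∧ y = v₂ ∧ I = .ioo v b) ∨ (x = v ∧ y = u ∧ I = .ico b a) ∨
      (x ∈ v₂ :: t ∧ (x, y) ∈ (Ear.mk v₂ t last).arcs ∧ I = .ioo x x) := by
    by_cases hxi : x ∈ v₂ :: t
    · exact .inr (.inr (.inr ⟨hxi, (row_new hxi).1 h⟩))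
    by_cases hxv : x = v
    · subst hxv
      by_cases h₁ : y = v₂
      · subst h₁
        rw [row_v₂] at h
        exact .inr (.inl ⟨rfl, rfl, h⟩)
      by_cases h₂ : y = u
      · subst h₂
        rw [row_u] at h
        exact .inr (.inr (.inl ⟨rfl, rfl, h⟩))
      rw [row_v h₁ h₂] at h
      refine .inl ⟨hv, h, ?_⟩
      rintro a' rfl
      exact absurd (huniq _ _ h).1 h₂
    · have hlab : I ∈ S.label x y := by
        simpa [hTl, assign, hxv, assignFull, show (x, y) ∉ (Ear.mk v₂ t last).arcs from
          fun h => hxi (hinner h)] using h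
      exact .inl ⟨(hS.arc_mem _ _ (hS.arc_of_label hlab)).1, hlab, fun _ _ => hxv⟩
  have mem_old {x y d : V} {I : CyclicInterval V} (hI : I ∈ S.label x y) (hd : d ∈ S.order) :
      I.Mem T.order d ↔ I.Mem S.order d := by
    rw [hTo]
    exact (hS.shape _ _ _ hI).mem_insertAfter_iff hv hnew
      (hS.arc_mem _ _ (hS.arc_of_label hI)).1 hd
  have mem_new {x y d : V} {I : CyclicInterval V} (hI : I ∈ S.label x y) (hd : d ∈ v₂ :: t)
      (hIv : ∀ a', I = .ioo x a' → x ≠ v) : I.Mem T.order d ↔ I.Mem S.order v := by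
    rw [hTo]
    exact (hS.shape _ _ _ hI).mem_insertAfter_inserted_iff hv hnew
      (hS.arc_mem _ _ (hS.arc_of_label hI)).1 hd hIv
  have mem_self {x d : V} (hx : x ∈ T.order) :
      (CyclicInterval.ioo x x).Mem T.order d ↔ d ∈ T.order ∧ d ≠ x := mem_ioo_self hx
  rw [← hTo] at memL
  rw [← hTo] at hico hico' hioo hioo'
  have harcs {x y : V} : (x, y) ∈ (Ear.mk v (v₂ :: t) last).arcs ↔
      (x = v ∧ y = v₂) ∨ (x, y) ∈ (Ear.mk v₂ t last).arcs := by
    simp [arcs_cons]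
  have hvT : v ∈ T.order := memL.2 (.inl hv)
  have v₂T : v₂ ∈ T.order := memL.2 (.inr (by simp))
  -- the routing steps in the new labeling
  have fwd_old {d x y : V} (hd : d ∈ S.order)
      (h : x ≠ d ∧ ∃ I ∈ S.label x y, I.Mem S.order d) :
      x ≠ d ∧ ∃ I ∈ T.label x y, I.Mem T.order d := by
    obtain ⟨hxd, I, hI, hm⟩ := h
    refine ⟨hxd, ?_⟩
    have hxy := hS.arc_mem _ _ (hS.arc_of_label hI)
    by_cases hxv : x = v
    · subst hxv
      by_cases hyu : y = u
      · subst hyu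
        obtain ⟨J, hJ, -⟩ := hS.label_arc _ _ (hS.arc_of_label hua)
        obtain rfl : I = .ioo x a := by
          rw [hJ] at hI hua
          exact hI.trans hua.symm
        exact ⟨_, by rw [row_u]; rfl, (hico d hd).2 hm⟩
      · exact ⟨I, by rwa [row_v (fun h => hnew v₂ (by simp) (h ▸ hxy.2)) hyu], (mem_old hI hd).2 hm⟩
    · exact ⟨I, by rwa [row_old hxy.1 hxv], (mem_old hI hd).2 hm⟩
  -- Away from `v`, a message for a new vertex is forwarded like one for `v`.
  have fwd_new {d x y : V} (hd : d ∈ v₂ :: t)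
      (h : x ≠ v ∧ ∃ I ∈ S.label x y, I.Mem S.order v) :
      x ≠ d ∧ ∃ I ∈ T.label x y, I.Mem T.order d := by
    obtain ⟨hxv, I, hI, hm⟩ := h
    have hxy := hS.arc_mem _ _ (hS.arc_of_label hI)
    exact ⟨fun h => hnew d hd (h ▸ hxy.1), I, by rwa [row_old hxy.1 hxv],
      (mem_new hI hd fun _ _ => hxv).2 hm⟩
  have fwd_ear {d x y : V} (hd : d ∈ T.order) (h : (x, y) ∈ (Ear.mk v₂ t last).arcs)
      (hxd : x ≠ d) : x ≠ d ∧ ∃ I ∈ T.label x y, I.Mem T.order d :=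
    ⟨hxd, _, (row_new (hinner h)).2 ⟨h, rfl⟩,
      (mem_self (memL.2 (.inr (hinner h)))).2 ⟨hd, hxd.symm⟩⟩
  refine ⟨T, fun T' => ⟨?_, ?_⟩, ⟨?_, ?_, ?_, ?_, ?_, ?_, ?_, ?_, ?_⟩, fun x => memL⟩
  · rintro ⟨w, q, u', a', b', hw, hq, hua', ho, ⟨hqT, rfl⟩, hl⟩
    simp only [innerArcs_cons] at hua' hl
    rw [hfull hv] at hua'
    obtain ⟨rfl, rfl⟩ := huniq _ _ hua'
    obtain rfl : v₂ = w := by simpa using hw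
    obtain rfl : p = q := Option.some.inj (hp.symm.trans hq)
    obtain ⟨o', l'⟩ := T'
    obtain rfl : o' = _ := ho
    exact Labeling.ext hTo.symm (hl.trans hTl.symm)
  · rintro rfl
    refine ⟨v₂, p, u, a, b, rfl, hp, ?_, hTo, ⟨hTo ▸ hpL, ?_⟩, hTl⟩
    · rw [innerArcs_cons, hfull hv]
      exact hua
    · simp only [hTo, hbdef]
  · rw [hTo]
    exact (perm_insertAfter _ hv).nodup_iff.2 (List.Nodup.append hn hS.nodup hnew)
  · rintro x y (h | h)
    · exact (hS.arc_mem _ _ h).imp (fun h => memL.2 (.inl h)) (fun h => memL.2 (.inl h))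
    · refine ⟨memL.2 ?_, memL.2 ?_⟩
      · exact (fst_mem_of_mem_arcs h).imp_left fun h => by simpa [h] using hv
      · exact (snd_mem_of_mem_arcs h).symm.imp_left fun h => by simpa [h] using hlast
  · intro x y h
    by_cases hxi : x ∈ v₂ :: t
    · have hxy : (x, y) ∈ (Ear.mk v₂ t last).arcs := by
        rcases h with h | h
        · exact absurd (hS.arc_mem _ _ h).1 (hnew x hxi)
        · exact (harcs.1 h).resolve_left fun h => hvin (h.1 ▸ hxi)
      refine ⟨.ioo x x, ?_, v, (mem_self (memL.2 (.inr hxi))).2 ⟨hvT, fun h => hvin (h ▸ hxi)⟩⟩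
      ext I
      simp [row_new hxi, hxy]
    by_cases hxv : x = v
    · subst hxv
      by_cases h₁ : y = v₂
      · subst h₁
        exact ⟨_, row_v₂, y, hioo' y (by simp)⟩
      by_cases h₂ : y = u
      · subst h₂
        obtain ⟨w, hw⟩ := hne
        exact ⟨_, row_u, w, (hico w hw.1).2 hw⟩
      have hA : A x y := h.resolve_right fun h =>
        (harcs.1 h).elim (fun h => h₁ h.2) fun h => hxi (hinner h)
      obtain ⟨I, hI, w, hw⟩ := hS.label_arc _ _ hA
      refine ⟨I, by rw [row_v h₁ h₂, hI], w, (mem_old (by rw [hI]; rfl) ?_).2 hw⟩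
      cases I <;> exact hw.1
    · have hA : A x y := h.resolve_right fun h =>
        (harcs.1 h).elim (fun h => hxv h.1) fun h => hxi (hinner h)
      obtain ⟨I, hI, w, hw⟩ := hS.label_arc _ _ hA
      refine ⟨I, by rw [row_old (hS.arc_mem _ _ hA).1 hxv, hI], w,
        (mem_old (by rw [hI]; rfl) ?_).2 hw⟩
      cases I <;> exact hw.1
  · intro x y h
    refine Set.eq_empty_iff_forall_notMem.2 fun I hI => h ?_
    rcases row_cases hI with h | ⟨rfl, rfl, -⟩ | ⟨rfl, rfl, -⟩ | h
    · exact .inl (hS.arc_of_label h.2.1)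
    · exact .inr (harcs.2 (.inl ⟨rfl, rfl⟩))
    · exact .inl (hS.arc_of_label hua)
    · exact .inr (harcs.2 (.inr h.2.1))
  · intro x y I hI
    rcases row_cases hI with h | ⟨rfl, rfl, rfl⟩ | ⟨rfl, rfl, rfl⟩ | ⟨hx, -, rfl⟩
    · rcases hS.shape _ _ _ h.2.1 with ⟨a', ha', rfl⟩ | ⟨b', hb', a', ha', rfl⟩
      · exact .inl ⟨a', memL.2 (.inl ha'), rfl⟩
      · exact .inr ⟨b', memL.2 (.inl hb'), a', memL.2 (.inl ha'), rfl⟩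
    · exact .inl ⟨b, memL.2 (.inl hb), rfl⟩
    · exact .inr ⟨b, memL.2 (.inl hb), a, memL.2 (.inl ha), rfl⟩
    · exact .inl ⟨x, memL.2 (.inr hx), rfl⟩
  · intro x hx
    by_cases hxi : x ∈ v₂ :: t
    · obtain ⟨y, hy⟩ := exists_mem_arcs (e := Ear.mk v₂ t last) hxi
      refine ⟨y, x, (row_new hxi).2 ⟨hy, rfl⟩, fun y' a' h => ?_⟩
      rw [row_new hxi] at h
      exact ⟨eq_of_mem_arcs (e := Ear.mk v₂ t last) hn h.1 hy, by simpa using h.2⟩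
    by_cases hxv : x = v
    · subst hxv
      refine ⟨v₂, b, by rw [row_v₂]; rfl, fun y' a' h => ?_⟩
      rcases row_cases h with h | ⟨-, rfl, h⟩ | ⟨-, -, h⟩ | h
      · exact absurd rfl (h.2.2 _ rfl)
      · exact ⟨rfl, by simpa using h⟩
      · cases h
      · exact absurd h.1 hxi
    · have hx' := (memL.1 hx).resolve_right hxi
      simpa only [row_old hx' hxv] using hS.free x hx'
  · intro x hx d hd hdx
    by_cases hxi : x ∈ v₂ :: t
    · obtain ⟨y, hy⟩ := exists_mem_arcs (e := Ear.mk v₂ t last) hxi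
      refine ⟨(y, .ioo x x), ⟨(row_new hxi).2 ⟨hy, rfl⟩, (mem_self hx).2 ⟨hd, hdx⟩⟩, ?_⟩
      rintro ⟨y', I⟩ ⟨h, -⟩
      rw [row_new hxi] at h
      exact Prod.ext (eq_of_mem_arcs (e := Ear.mk v₂ t last) hn h.1 hy) h.2
    have hx' := (memL.1 hx).resolve_right hxi
    by_cases hdi : d ∈ v₂ :: t
    · by_cases hxv : x = v
      · subst hxv
        refine ⟨(v₂, .ioo x b), ⟨by rw [row_v₂]; rfl, hioo' d hdi⟩, ?_⟩
        rintro ⟨y', I⟩ ⟨h, hm⟩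
        rcases row_cases h with h | ⟨-, h₁, rfl⟩ | ⟨-, -, rfl⟩ | h
        · exact absurd ((mem_new h.2.1 hdi h.2.2).1 hm) (hS.not_mem_self _ _ _ h.2.1)
        · exact Prod.ext h₁ rfl
        · exact absurd hm (hico' d hdi)
        · exact absurd h.1 hxi
      · obtain ⟨q, ⟨hq₁, hq₂⟩, hq⟩ := hS.cover x hx' v hv (Ne.symm hxv)
        refine ⟨q, ⟨by rwa [row_old hx' hxv], (mem_new hq₁ hdi fun _ _ => hxv).2 hq₂⟩, ?_⟩
        rintro q' ⟨h, hm⟩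
        rw [row_old hx' hxv] at h
        exact hq q' ⟨h, (mem_new h hdi fun _ _ => hxv).1 hm⟩
    · have hd' := (memL.1 hd).resolve_right hdi
      obtain ⟨q, ⟨hq₁, hq₂⟩, hq⟩ := hS.cover x hx' d hd' hdx
      obtain ⟨-, J, hJ, hJm⟩ := fwd_old hd' ⟨hdx.symm, q.2, hq₁, hq₂⟩
      refine ⟨(q.1, J), ⟨hJ, hJm⟩, ?_⟩
      -- The interval containing `d` may have been replaced by `[b,a)`, but it stays on the same
      -- arc. So uniqueness is proved first for the arc, then for the interval.
      have key : ∀ y' I, I ∈ T.label x y' → I.Mem T.order d → y' = q.1 := by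
        intro y' I h hm
        rcases row_cases h with h | ⟨rfl, rfl, rfl⟩ | ⟨rfl, rfl, rfl⟩ | h
        · exact congrArg Prod.fst (hq (y', I) ⟨h.2.1, (mem_old h.2.1 hd').1 hm⟩)
        · exact absurd hm (hioo d hd')
        · exact congrArg Prod.fst (hq (y', .ioo x a) ⟨hua, (hico d hd').1 hm⟩)
        · exact absurd h.1 hxi
      rintro ⟨y', I⟩ ⟨h, hm⟩
      have hy' := key y' I h hm
      subst hy'
      refine Prod.ext rfl ?_
      rcases row_cases h with h₁ | ⟨rfl, h₁, rfl⟩ | ⟨rfl, h₁, rfl⟩ | h₁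
      · rcases row_cases hJ with h₂ | ⟨rfl, h₂, rfl⟩ | ⟨rfl, h₂, rfl⟩ | h₂
        · exact congrArg Prod.snd ((hq (q.1, I) ⟨h₁.2.1, (mem_old h₁.2.1 hd').1 hm⟩).trans
            (hq (q.1, J) ⟨h₂.2.1, (mem_old h₂.2.1 hd').1 hJm⟩).symm)
        · exact absurd hJm (hioo d hd')
        · rw [h₂, row_u] at h
          exact h
        · exact absurd h₂.1 hxi
      · exact absurd hm (hioo d hd')
      · rw [h₁, row_u] at hJ
        exact hJ.symm
      · exact absurd h₁.1 hxi
  · intro x y I hI hm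
    rcases row_cases hI with h | ⟨rfl, rfl, rfl⟩ | ⟨rfl, rfl, rfl⟩ | ⟨hx, -, rfl⟩
    · exact hS.not_mem_self _ _ _ h.2.1 ((mem_old h.2.1 h.1).1 hm)
    · exact hioo _ hv hm
    · exact hS.not_mem_self _ _ _ hua ((hico _ hv).1 hm)
    · exact ((mem_self (memL.2 (.inr hx))).1 hm).2 rfl
  · intro x hx d hd
    obtain ⟨hpath, -⟩ := reaches_of_arcs (d := d)
      (R := fun u v => u ≠ d ∧ ∃ I ∈ T.label u v, I.Mem T.order d) t v₂ last
      (fun x y hxy hxd => fwd_ear hd hxy hxd)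
    suffices hold : ∀ x ∈ S.order, Relation.ReflTransGen
        (fun u v => u ≠ d ∧ ∃ I ∈ T.label u v, I.Mem T.order d) x d by
      rcases memL.1 hx with hx | hx
      · exact hold x hx
      · exact (hpath x hx).elim id fun h => h.trans (hold last hlast)
    intro x hx
    rcases memL.1 hd with hd' | hd'
    · exact Relation.ReflTransGen.mono (fun _ _ => fwd_old hd') _ _ (hS.feasible x hx d hd')
    -- The message first follows the old route to `v`, then the ear up to `d`.
    · have hvd : v ≠ d := fun h => hvin (h ▸ hd')
      have hreach := (reaches_of_arcs (d := d)
        (R := fun u v => u ≠ d ∧ ∃ I ∈ T.label u v, I.Mem T.order d) (v₂ :: t) v last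
        (fun x y hxy hxd => by
          rcases harcs.1 hxy with ⟨rfl, rfl⟩ | hxy
          · exact ⟨hxd, _, by rw [row_v₂]; rfl, hioo' d hd'⟩
          · exact fwd_ear hd hxy hxd)).2 (List.mem_cons_of_mem _ hd')
      exact (Relation.ReflTransGen.mono (fun _ _ => fwd_new hd') _ _ (hS.feasible x hx v hv)).trans hreach

/-- The last conjunct also covers single-arc ears, which the procedure skips; it serves to show that
every vertex gets into the order. -/
theorem IsRoutingState.run {S : Labeling V} {A : V → V → Prop} (hS : IsRoutingState S A)
    {W : Set V} (hW : ∀ x, x ∈ S.order ↔ x ∈ W) (ears : List (Ear V)) (h : EarsAttach W ears) :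
    ∃ T, (∀ T', RoutingRun S (longEars ears) T' ↔ T' = T) ∧
      IsRoutingState T (fun x y => A x y ∨ (x, y) ∈ (longEars ears).flatMap Ear.arcs) ∧
      (∀ x ∈ S.order, x ∈ T.order) ∧
      ∀ x y, (x, y) ∈ ears.flatMap Ear.arcs → x ∈ T.order := by
  induction ears generalizing S A W with
  | nil => exact ⟨S, fun _ => Iff.rfl, by simpa [longEars] using hS, fun _ => id, by simp⟩
  | cons e es ih =>
    obtain ⟨v, inner, last⟩ := e
    obtain ⟨hv, hlast, hn, hnew, hes⟩ := h
    rw [← hW] at hv hlast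
    obtain _ | ⟨v₂, t⟩ := inner
    · obtain ⟨T, h₁, h₂, h₃, h₄⟩ := ih hS (by simpa using hW) hes
      have hl : longEars (⟨v, [], last⟩ :: es) = longEars es := by simp [longEars]
      rw [hl]
      refine ⟨T, h₁, h₂, h₃, fun x y hxy => ?_⟩
      rw [List.flatMap_cons, List.mem_append, arcs_nil] at hxy
      rcases hxy with hxy | hxy
      · obtain ⟨rfl, -⟩ : x = v ∧ y = last := by simpa using hxy
        exact h₃ _ hv
      · exact h₄ x y hxy
    · obtain ⟨S', hstep, hS', hord⟩ :=
        hS.step hv hlast hn fun y hy hyS => hnew y hy ((hW y).1 hyS)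
      obtain ⟨T, h₁, h₂, h₃, h₄⟩ := ih hS' (fun x => by rw [hord, hW]; rfl) hes
      have hl : longEars (⟨v, v₂ :: t, last⟩ :: es) = ⟨v, v₂ :: t, last⟩ :: longEars es := by
        simp [longEars]
      rw [hl]
      refine ⟨T, fun T' => ?_, h₂.congr fun x y => by rw [List.flatMap_cons, List.mem_append,
        or_assoc], fun x hx => h₃ x ((hord x).2 (.inl hx)), fun x y hxy => ?_⟩
      · simp only [RoutingRun, hstep, exists_eq_left, h₁]
      · rw [List.flatMap_cons, List.mem_append] at hxy
        rcases hxy with hxy | hxy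
        · exact h₃ x ((hord x).2 ((fst_mem_of_mem_arcs hxy).imp_left fun h => by
            simpa [h] using hv))
        · exact h₄ x y hxy

theorem routing_correct {G : Digraph V} (hG : StronglyConnected G) {c : List V}
    {ears : List (Ear V)} (h : IsEarDecomposition G c ears) :
    ∃ S : Labeling V, (∀ T, Routing c (longEars ears) T ↔ T = S) ∧
      IsIntervalRoutingScheme G S ∧ Feasible G S ∧
      (∀ u v : V, (u, v) ∈ allArcs c (longEars ears) →
        ∃ I, S.label u v = {I} ∧ ∃ w, I.Mem S.order w) ∧
      (∀ u v : V, (u, v) ∉ allArcs c (longEars ears) → S.label u v = ∅) := by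
  have hinit := isRoutingState_routingInit h.nodup h.two_le_length
  obtain ⟨S, h₁, h₂, h₃, h₄⟩ := hinit.run (W := {v | v ∈ c}) (fun _ => Iff.rfl) ears h.attach
  have hS : IsRoutingState S fun u v => (u, v) ∈ allArcs c (longEars ears) :=
    h₂.congr fun u v => by rw [allArcs, List.mem_append]
  -- A vertex off the cycle has a path to it, hence an outgoing arc, which belongs to the cycle or
  -- to an ear.
  have hall : ∀ x, x ∈ S.order := by
    intro x
    by_cases hx : x ∈ c
    · exact h₃ x hx
    obtain ⟨f, hf⟩ : ∃ f, f ∈ c := List.exists_mem_of_length_pos (by have := h.two_le_length; omega)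
    rcases Relation.ReflTransGen.cases_head (hG x f) with rfl | ⟨y, hxy, -⟩
    · exact absurd hf hx
    · rw [h.adj_iff, allArcs, List.mem_append] at hxy
      rcases hxy with hxy | hxy
      · exact absurd (List.of_mem_zip hxy).1 hx
      · exact h₄ x y hxy
  have hadj {u v : V} {I : CyclicInterval V} (hI : I ∈ S.label u v) : G.Adj u v :=
    (h.adj_iff u v).2 (longEars_arcs_subset (hS.arc_of_label hI))
  exact ⟨S, h₁, ⟨hS.nodup, hall, fun u v ⟨I, hI⟩ => hadj hI,
    fun u d hdu => hS.cover u (hall u) d (hall d) hdu, hS.not_mem_self⟩,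
    fun x d => Relation.ReflTransGen.mono
      (fun u v ⟨hud, I, hI, hm⟩ => ⟨hud, hadj hI, I, hI, hm⟩) _ _
      (hS.feasible x (hall x) d (hall d)), hS.label_arc, hS.label_nonarc⟩

/-! ### Schemes with one interval per arc -/

theorem exists_empty_interval {L : List V} (hL : L.Nodup) {u : V} (hu : u ∈ L) :
    ∃ I : CyclicInterval V, ∀ w, ¬ I.Mem L w := by
  have hb := List.next_mem L u hu
  have h₁ := List.idxOf_lt_length_iff.2 hu
  have h₂ := idxOf_next hL hu
  refine ⟨.ioo u (L.next u hu), fun w hw => ?_⟩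
  have hwL : w ∈ L := hw.1
  have h₃ := List.idxOf_lt_length_iff.2 hwL
  rw [mem_ioo_iff hu hb hwL, h₂] at hw
  -- With one vertex, the interval is `(u,u)`, which is empty because there is no other vertex.
  by_cases hlen : L.length = 1
  · rw [if_neg (by omega)] at hw
    omega
  · split_ifs at hw <;> omega

/-- A feasible scheme in which the arcs outside of `H` carry no interval can be completed with
empty intervals. -/
theorem exists_scheme_of_subdigraph {G H : Digraph V} {S : Labeling V}
    (hS : IsIntervalRoutingScheme G S) (hF : Feasible G S)
    (hH : ∀ u v, H.Adj u v → ∃ I, S.label u v = {I} ∧ ∃ w, I.Mem S.order w)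
    (hH' : ∀ u v, ¬ H.Adj u v → S.label u v = ∅) :
    ∃ S : Labeling V, IsIntervalRoutingScheme G S ∧ Feasible G S ∧
      ∀ u v : V, G.Adj u v →
        ∃ I, S.label u v = {I} ∧ ((∃ w, I.Mem S.order w) ↔ H.Adj u v) := by
  classical
  choose E hE using fun u => exists_empty_interval hS.nodup (hS.mem_order u)
  let lab : V → V → Set (CyclicInterval V) := fun u v =>
    if G.Adj u v ∧ ¬ H.Adj u v then {E u} else S.label u v
  -- Empty intervals contain no destination, so covering and forwarding are unaffected.
  have hlab {u v d : V} {I : CyclicInterval V} :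
      I ∈ lab u v ∧ I.Mem S.order d ↔ I ∈ S.label u v ∧ I.Mem S.order d := by
    simp only [lab]
    split_ifs with h
    · simp only [Set.mem_singleton_iff, hH' u v h.2, Set.mem_empty_iff_false, false_and, iff_false]
      rintro ⟨rfl, hm⟩
      exact hE u d hm
    · rfl
  refine ⟨⟨S.order, lab⟩, ⟨hS.nodup, hS.mem_order, fun u v h => ?_, fun u d hdu => ?_,
    fun u v I hI hm => hS.not_mem_self u v I (hlab.1 ⟨hI, hm⟩).1 hm⟩, fun x d => ?_, fun u v h => ?_⟩
  · by_contra hG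
    simp only [lab, hG, false_and, if_false] at h
    exact hG (hS.adj_of_label u v h)
  · simpa only [hlab] using hS.cover u d hdu
  · exact Relation.ReflTransGen.mono (fun u v ⟨hud, huv, I, hI⟩ => ⟨hud, huv, I, hlab.2 hI⟩) _ _
      (hF x d)
  · by_cases hHuv : H.Adj u v
    · obtain ⟨I, hI, hw⟩ := hH u v hHuv
      exact ⟨I, by simp [lab, hHuv, hI], by simp [hHuv, hw]⟩
    · exact ⟨E u, by simp [lab, hHuv, h], by simp [hHuv, hE]⟩

theorem exists_scheme [Finite V] {G : Digraph V} (hG : StronglyConnected G) :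
    ∃ H : Digraph V, H ≤ G ∧ StronglyConnected H ∧
      ∃ S : Labeling V, IsIntervalRoutingScheme G S ∧ Feasible G S ∧
        ∀ u v : V, G.Adj u v →
          ∃ I, S.label u v = {I} ∧ ((∃ w, I.Mem S.order w) ↔ H.Adj u v) := by
  rcases subsingleton_or_nontrivial V with hV | hV
  -- A single vertex admits no initial cycle, but nothing needs routing; a possible loop gets an
  -- empty interval.
  · have := Fintype.ofFinite V
    refine ⟨⊥, bot_le, fun u v => Subsingleton.elim u v ▸ .refl,
      exists_scheme_of_subdigraph (S := ⟨Finset.univ.toList, fun _ _ => ∅⟩)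
        ⟨Finset.nodup_toList _, by simp, by simp, fun u d h => absurd (Subsingleton.elim d u) h,
          by simp⟩ (fun u v => Subsingleton.elim u v ▸ .refl) (fun u v h => h.elim) (by simp)⟩
  · obtain ⟨c, ears, h⟩ := exists_isEarDecomposition hG
    obtain ⟨S, -, hS, hF, h₁, h₂⟩ := routing_correct hG h
    let H : Digraph V := ⟨fun u v => (u, v) ∈ allArcs c (longEars ears)⟩
    have hHG : H ≤ G := fun u v huv => (h.adj_iff u v).2 (longEars_arcs_subset huv)
    -- Messages use only labeled arcs, and these lie in `H`, so feasibility makes `H` strongly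
    -- connected.
    refine ⟨H, hHG, fun x d => Relation.ReflTransGen.mono ?_ _ _ (hF x d),
      exists_scheme_of_subdigraph hS hF h₁ h₂⟩
    rintro u v ⟨-, -, I, hI, -⟩
    by_contra hH
    simp [h₂ u v hH] at hI

end IntervalRouting

theorem mainTheorem5 {V : Type*} [Finite V] [DecidableEq V] (G : Digraph V)
    (hG : IntervalRouting.StronglyConnected G) :
    -- an ear decomposition exists
    (Nontrivial V → ∃ (c : List V) (ears : List (IntervalRouting.Ear V)),
      IntervalRouting.IsEarDecomposition G c ears) ∧
    -- on every ear decomposition, freed of its single-arc ears, the procedure has exactly one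
    -- possible output, a feasible interval routing scheme with one interval per arc
    (∀ (c : List V) (ears : List (IntervalRouting.Ear V)),
      IntervalRouting.IsEarDecomposition G c ears →
      ∃ S : IntervalRouting.Labeling V,
        (∀ T, IntervalRouting.Routing c (IntervalRouting.longEars ears) T ↔ T = S) ∧
        IntervalRouting.IsIntervalRoutingScheme G S ∧
        IntervalRouting.Feasible G S ∧
        (∀ u v : V, (u, v) ∈ IntervalRouting.allArcs c (IntervalRouting.longEars ears) →
          ∃ I, S.label u v = {I} ∧ ∃ w, I.Mem S.order w) ∧
        (∀ u v : V, (u, v) ∉ IntervalRouting.allArcs c (IntervalRouting.longEars ears) →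
          S.label u v = ∅)) ∧
    -- so every strongly connected digraph has a feasible scheme with one interval per arc,
    -- where the nonempty intervals are those on the arcs of a strongly connected subdigraph
    (∃ H : Digraph V, H ≤ G ∧ IntervalRouting.StronglyConnected H ∧
      ∃ S : IntervalRouting.Labeling V,
        IntervalRouting.IsIntervalRoutingScheme G S ∧
        IntervalRouting.Feasible G S ∧
        (∀ u v : V, G.Adj u v →
          ∃ I, S.label u v = {I} ∧ ((∃ w, I.Mem S.order w) ↔ H.Adj u v))) := by
  exact ⟨fun _ => IntervalRouting.exists_isEarDecomposition hG,
    fun _ _ => IntervalRouting.routing_correct hG, IntervalRouting.exists_scheme hG⟩
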